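/- Let $D_R=\{z\in\mathbb C:|z|\le R\}$. A complex Brownian motion is $B=\frac1{\sqrt2}(B_1+iB_2)$ with $B_1,B_2$ independent standard real Brownian motions started from $0$, and the (stationary) complex Ornstein--Uhlenbeck process is $\zeta(t)=e^{-t/2}B(e^t)$, $t\ge 0$. Fix a constant $c\in\mathbb C\setminus\{0\}$ and consider three systems of moving points in $\mathbb C$, points being counted with multiplicity: (pp) the Brownian Poisson model: the points at time $0$ form a Poisson process with intensity $\pi^{-1}dm$ ($m$ Lebesgue measure on $\mathbb C$), and each point then moves by a complex Brownian motion, these motions being independent of each other and of the initial configuration; (pl) the perturbed lattice model: the points at time $t$ are $\sqrt\pi(k+i\ell)+c\,\zeta_{k,\ell}(t)$, $k,\ell\in\mathbb Z$; (tc) the triangular cluster model: the points at time $t$ are $\sqrt{3\pi}(k+i\ell)+c\,e^{2\pi i m/3}\zeta_{k,\ell}(t)$, $k,\ell\in\mathbb Z$, $m=0,1,2$; where the $\zeta_{k,\ell}$ are independent complex Ornstein--Uhlenbeck processes. For $k\in\{pp,pl,tc\}$ let $C_k(T,R,N)$ be the event that for every $t\in[0,T]$ at least $N$ points of model $k$ lie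 in $D_R$. Then there is an absolute constant $C>0$ such that for all $R>0$ and all integers $N\ge0$ $$\liminf_{T\to\infty}\frac1T\log\mathbb P(C_{pp}(T,R,N))\ \ge\ -\frac{CN}{R^2}.$$ Moreover, for every $R>0$ there is a constant $C(R)>0$ (depending only on $R$ and on the model constant $c$) such that for all integers $N\ge0$ and for $k=pl$ and $k=tc$ $$\liminf_{T\to\infty}\frac1T\log\mathbb P(C_k(T,R,N))\ \ge\ -C(R)N^2.$$ Here $\log 0=-\infty$. -/

import Mathlib

open MeasureTheory ProbabilityTheory Filter
open scoped NNReal ENNReal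

noncomputable section

namespace ToyModels

/-- `D_R = {z ∈ ℂ : |z| ≤ R}`. -/
def disk (R : ℝ) : Set ℂ := {z | ‖z‖ ≤ R}

/-- A complex Brownian motion started from `0`, `B = (B₁ + i B₂) / √2` with `B₁, B₂` independent
standard real Brownian motions (almost surely continuous paths). -/
structure IsComplexBrownian {Ω : Type*} [MeasurableSpace Ω] (B : ℝ≥0 → Ω → ℂ)
    (P : Measure Ω) : Prop where
  measurable : ∀ t, Measurable (B t)
  re : IsBrownianReal (fun t ω => √2 * (B t ω).re) P
  im : IsBrownianReal (fun t ω => √2 * (B t ω).im) P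
  indep : IndepFun (fun ω t => (B t ω).re) (fun ω t => (B t ω).im) P

/-- A family of independent complex Brownian motions (independent as random paths). -/
structure IsBrownianFamily {ι Ω : Type*} [MeasurableSpace Ω] (B : ι → ℝ≥0 → Ω → ℂ)
    (P : Measure Ω) : Prop where
  brownian : ∀ i, IsComplexBrownian (B i) P
  indep : iIndepFun (fun i ω t => B i t ω) P

/-- The stationary complex Ornstein-Uhlenbeck process `W(t) = e^{-t/2} B(e^t)` driven by the
Brownian path `B`, for `t ≥ 0`. -/
def ornsteinUhlenbeck {Ω : Type*} (B : ℝ≥0 → Ω → ℂ) (t : ℝ≥0) (ω : Ω) : ℂ :=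
  (Real.exp (-(t : ℝ) / 2) : ℂ) * B (Real.exp (t : ℝ)).toNNReal ω

/-- The number of indices `i` for which the point `Z i ω` lies in `A`. -/
def pointCount {ι Ω : Type*} (Z : ι → Ω → ℂ) (A : Set ℂ) (ω : Ω) : ℕ∞ :=
  {i | Z i ω ∈ A}.encard

/-- `Z` is a measurable enumeration of the points of a Poisson process in `ℂ` with intensity
measure `Λ`: the number of points in a Borel set `A` with `Λ A < ∞` is Poisson with mean `Λ A`,
and the numbers of points in disjoint Borel sets are independent. -/
structure IsPoissonProcess {Ω : Type*} [MeasurableSpace Ω] (Z : ℕ → Ω → ℂ) (Λ : Measure ℂ)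
    (P : Measure Ω) : Prop where
  measurable : ∀ i, Measurable (Z i)
  law : ∀ A : Set ℂ, MeasurableSet A → Λ A ≠ ∞ → ∀ n : ℕ,
    P {ω | pointCount Z A ω = n} = poissonMeasure (Λ A).toNNReal {n}
  indep : ∀ (m : ℕ) (A : Fin m → Set ℂ), (∀ j, MeasurableSet (A j)) →
    Pairwise (fun j k => Disjoint (A j) (A k)) →
    iIndepFun (fun j ω => pointCount Z (A j) ω) P

/-- The data of the Brownian Poisson model: initial positions `Z` forming a Poisson process of
intensity `π⁻¹ dm`, and independent complex Brownian motions `B i`, independent of `Z`. -/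
structure IsBrownianPoisson {Ω : Type*} [MeasurableSpace Ω] (Z : ℕ → Ω → ℂ)
    (B : ℕ → ℝ≥0 → Ω → ℂ) (P : Measure Ω) : Prop where
  poisson : IsPoissonProcess Z (ENNReal.ofReal Real.pi⁻¹ • (volume : Measure ℂ)) P
  brownian : IsBrownianFamily B P
  indep : IndepFun (fun ω i => Z i ω) (fun ω i t => B i t ω) P

/-- The points of the Brownian Poisson model at time `t`. -/
def poissonPoint {Ω : Type*} (Z : ℕ → Ω → ℂ) (B : ℕ → ℝ≥0 → Ω → ℂ)
    (i : ℕ) (t : ℝ≥0) (ω : Ω) : ℂ :=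
  Z i ω + B i t ω

/-- The points `√π (k + iℓ) + c ζ_{k,ℓ}(t)` of the perturbed lattice model, where `ζ_{k,ℓ}` is the
Ornstein-Uhlenbeck process driven by `B (k, ℓ)`. -/
def latticePoint {Ω : Type*} (c : ℂ) (B : ℤ × ℤ → ℝ≥0 → Ω → ℂ)
    (p : ℤ × ℤ) (t : ℝ≥0) (ω : Ω) : ℂ :=
  (√Real.pi : ℂ) * ((p.1 : ℂ) + Complex.I * (p.2 : ℂ)) + c * ornsteinUhlenbeck (B p) t ω

/-- The points `√(3π) (k + iℓ) + c e^{2πi m/3} ζ_{k,ℓ}(t)`, `m = 0, 1, 2`, of the triangular cluster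
model, where `ζ_{k,ℓ}` is the Ornstein-Uhlenbeck process driven by `B (k, ℓ)`. -/
def clusterPoint {Ω : Type*} (c : ℂ) (B : ℤ × ℤ → ℝ≥0 → Ω → ℂ)
    (q : (ℤ × ℤ) × Fin 3) (t : ℝ≥0) (ω : Ω) : ℂ :=
  (√(3 * Real.pi) : ℂ) * ((q.1.1 : ℂ) + Complex.I * (q.1.2 : ℂ))
    + c * Complex.exp (2 * (Real.pi : ℂ) * Complex.I * ((q.2 : ℕ) : ℂ) / 3)
      * ornsteinUhlenbeck (B q.1) t ω

/-- The overcrowding event: at every time `t ∈ [0, T]` at least `N` of the moving points `X i`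
lie in `D_R`. -/
def overcrowding {ι Ω : Type*} (X : ι → ℝ≥0 → Ω → ℂ) (T : ℝ≥0) (R : ℝ) (N : ℕ) : Set Ω :=
  {ω | ∀ t ∈ Set.Icc 0 T, (N : ℕ∞) ≤ pointCount (fun i => X i t) (disk R) ω}

/-- `liminf_{T → ∞} (1/T) log P(E T)`, as an extended real number (with `log 0 = -∞`). -/
def lowerRate {Ω : Type*} [MeasurableSpace Ω] (P : Measure Ω) (E : ℝ≥0 → Set Ω) : EReal :=
  liminf (fun T : ℝ≥0 => ((1 / (T : ℝ) : ℝ) : EReal) * ENNReal.log (P (E T))) atTop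

end ToyModels

end

open ToyModels

/-!
A cheap way to have `N` points in the disk during all of `[0, T]` is to choose `N` points and keep
each of them in the disk. The chosen points are driven by independent Brownian motions, and the two
coordinates of each are independent, so the probability is at least a product of `2 N` confinement
probabilities of real processes. Everything rests on exponential lower bounds for these.

For real Brownian motion, cut time into blocks. In a block of length `σ ^ 2`, with a probability at
least `p > 0` that depends on nothing (`exists_dropPaths_bound`), the path moves by at least `σ` in a
given direction while never moving by more than `K σ`. Choosing in each block the direction of the
centre of a tube keeps the path in a tube of width of order `K σ`, and by the Markov property `n`
blocks succeed with probability at least `p ^ n` (`exists_steered`, `tube_probability`). This also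
allows a moving centre, provided that it moves by at most `σ` during each block.

* Confinement of Brownian motion to `[-r, r]` uses blocks of length of order `r ^ 2`, hence has a rate
  of order `1 / r ^ 2` (`exists_brownian_confinement`). For the Poisson model, `N` points with fixed
  indices start in the disk of radius `R / 2` with positive probability, and then each of them has to
  stay within `R / 2` of its starting point: the total rate is of order `N / R ^ 2`.
* Confinement of the Ornstein-Uhlenbeck process `e^{-t/2} B(e^t)` to a neighbourhood of `m` means that
  `B` follows the centre `m √v` in a tube of width of order `√v`. The blocks now have length of order
  `1 / (1 + m ^ 2)` in the time `t`, which gives a rate of order `1 + m ^ 2`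
  (`exists_ornsteinUhlenbeck_confinement`). For the lattice models, the `N` sites closest to the origin
  have squared distance to it of order at most `N`, so that the total rate is of order `N ^ 2`. In the
  triangular cluster model only one point of each cluster is used.
-/

namespace ToyModels

/-! ### Controlled blocks of Brownian motion -/

/-- Paths that go down by at least `1` during the time interval `[0, 1]` while staying in `[-K, K]`.
The bound is only required along a countable dense set of times, truncated at `1`, which makes the
set measurable; for continuous paths this is the same as requiring it on all of `[0, 1]`. -/
def dropPaths (K : ℝ) : Set (ℝ≥0 → ℝ) :=
  {x | x 1 ≤ -1 ∧ ∀ n, |x (min (TopologicalSpace.denseSeq ℝ≥0 n) 1)| ≤ K}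

/-- Paths that stay within distance `ρ` of `m` during `[0, T]`, with the condition again imposed
along a countable dense set of times truncated at `T`. -/
def confinedPaths (T : ℝ≥0) (m ρ : ℝ) : Set (ℝ≥0 → ℝ) :=
  {x | ∀ n, |x (min (TopologicalSpace.denseSeq ℝ≥0 n) T) - m| ≤ ρ}

/-- The increment of the path `x` after time `t`, in Brownian scaling with spatial scale `σ`. -/
noncomputable def rescaledIncrement (x : ℝ≥0 → ℝ) (t σ : ℝ≥0) : ℝ≥0 → ℝ :=
  fun u => (σ : ℝ)⁻¹ * (x (t + σ ^ 2 * u) - x t)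

lemma measurableSet_dropPaths (K : ℝ) : MeasurableSet (dropPaths K) := by
  have h : dropPaths K = {x : ℝ≥0 → ℝ | x 1 ≤ -1} ∩
      ⋂ n, {x | |x (min (TopologicalSpace.denseSeq ℝ≥0 n) 1)| ≤ K} := by
    ext x; simp [dropPaths]
  rw [h]
  refine (measurableSet_le (measurable_pi_apply _) measurable_const).inter
    (MeasurableSet.iInter fun n => measurableSet_le ?_ measurable_const)
  exact (measurable_pi_apply _).abs

lemma measurableSet_confinedPaths (T : ℝ≥0) (m ρ : ℝ) : MeasurableSet (confinedPaths T m ρ) := by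
  have h : confinedPaths T m ρ =
      ⋂ n, {x | |x (min (TopologicalSpace.denseSeq ℝ≥0 n) T) - m| ≤ ρ} := by
    ext x; simp [confinedPaths]
  rw [h]
  exact MeasurableSet.iInter fun n =>
    measurableSet_le (by fun_prop) measurable_const

lemma mem_confinedPaths_iff {x : ℝ≥0 → ℝ} (hx : Continuous x) {T : ℝ≥0} {m ρ : ℝ} :
    x ∈ confinedPaths T m ρ ↔ ∀ t ≤ T, |x t - m| ≤ ρ := by
  refine ⟨fun h t ht => ?_, fun h n => h _ (min_le_right _ _)⟩
  have hc : IsClosed {s : ℝ≥0 | |x (min s T) - m| ≤ ρ} :=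
    isClosed_le (by fun_prop) continuous_const
  have hs : Set.range (TopologicalSpace.denseSeq ℝ≥0) ⊆ {s : ℝ≥0 | |x (min s T) - m| ≤ ρ} := by
    rintro _ ⟨n, rfl⟩
    exact h n
  have := hc.closure_subset_iff.2 hs (TopologicalSpace.denseRange_denseSeq ℝ≥0 t)
  simpa [min_eq_left ht] using this

lemma mem_dropPaths_iff {x : ℝ≥0 → ℝ} (hx : Continuous x) {K : ℝ} :
    x ∈ dropPaths K ↔ x 1 ≤ -1 ∧ ∀ t ≤ 1, |x t| ≤ K := by
  have := mem_confinedPaths_iff hx (T := 1) (m := 0) (ρ := K)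
  simp only [confinedPaths, sub_zero, Set.mem_ofPred_eq] at this
  simp only [dropPaths, Set.mem_ofPred_eq, this]

section Brownian

variable {Ω : Type*} [MeasurableSpace Ω] {P : Measure Ω} {X : ℝ≥0 → Ω → ℝ}

/-- The law of a Brownian path is the projective limit of the Brownian finite-dimensional laws; in
particular any two Brownian motions have the same law, whatever the underlying spaces. -/
lemma isProjectiveLimit_brownianLaw (hX : IsBrownianReal X P) (hm : ∀ t, Measurable (X t)) :
    IsProjectiveLimit (P.map fun ω t => X t ω) BrownianReal.projectiveFamily := by
  intro I
  rw [Measure.map_map (Finset.measurable_restrict I) (measurable_pi_lambda _ hm)]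
  exact (hX.hasLaw I).map_eq

lemma exists_dropPaths_pos (hX : IsBrownianReal X P) :
    ∃ K : ℕ, P {ω | (fun t => X t ω) ∈ dropPaths (K + 1)} ≠ 0 := by
  by_contra! h
  have hU : P (⋃ K : ℕ, {ω | (fun t => X t ω) ∈ dropPaths (K + 1)}) = 0 := measure_iUnion_null h
  have h1 : P {ω | X 1 ω ≤ -1} ≠ 0 := by
    rw [(hX.hasLaw_eval 1).measure_eq (p := fun y => y ≤ -1) measurableSet_Iic]
    intro h0
    have h2 := gaussianReal_absolutelyContinuous' 0 (v := 1) one_ne_zero h0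
    rw [show {y : ℝ | y ≤ -1} = Set.Iic (-1) from rfl, Real.volume_Iic] at h2
    exact ENNReal.top_ne_zero h2
  refine h1 (measure_mono_null_ae ?_ hU)
  filter_upwards [hX.cont] with ω hω h
  obtain ⟨K₀, hK₀⟩ := (isCompact_Icc (a := (0 : ℝ≥0)) (b := 1)).exists_bound_of_continuousOn
    hω.continuousOn
  obtain ⟨K, hK⟩ := exists_nat_ge K₀
  refine Set.mem_iUnion.2 ⟨K, (mem_dropPaths_iff hω).2 ⟨h, fun t ht => ?_⟩⟩
  exact (hK₀ t ⟨zero_le, ht⟩).trans (by linarith)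

end Brownian

/-- There are a scale `K` and a probability `p > 0` such that every Brownian motion drops by at least
`1` within unit time while staying in `[-K, K]` with probability at least `p`. Since all Brownian
motions have the same law, constants that work for one of them work for all. -/
lemma exists_dropPaths_bound : ∃ K p : ℝ, 0 < K ∧ 0 < p ∧ p ≤ 1 ∧
    ∀ (Ω : Type*) [MeasurableSpace Ω] (P : Measure Ω) [IsProbabilityMeasure P] (X : ℝ≥0 → Ω → ℝ),
      IsBrownianReal X P → (∀ t, Measurable (X t)) →
        p ≤ P.real {ω | (fun t => X t ω) ∈ dropPaths K} := by
  by_cases h : ∃ (Ω : Type _) (_ : MeasurableSpace Ω) (P : Measure Ω) (_ : IsProbabilityMeasure P)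
      (X : ℝ≥0 → Ω → ℝ), IsBrownianReal X P ∧ ∀ t, Measurable (X t)
  · obtain ⟨Ω, _, P, _, X, hX, hm⟩ := h
    obtain ⟨K, hK⟩ := exists_dropPaths_pos hX
    refine ⟨K + 1, P.real {ω | (fun t => X t ω) ∈ dropPaths (K + 1)}, by positivity,
      ENNReal.toReal_pos hK (measure_ne_top _ _), measureReal_le_one, ?_⟩
    intro Ω' _ P' _ Y hY hmY
    have hlaw := (isProjectiveLimit_brownianLaw hX hm).unique (isProjectiveLimit_brownianLaw hY hmY)
    have e1 := Measure.map_apply (μ := P) (measurable_pi_lambda _ hm)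
      (measurableSet_dropPaths (K + 1))
    have e2 := Measure.map_apply (μ := P') (measurable_pi_lambda _ hmY)
      (measurableSet_dropPaths (K + 1))
    rw [hlaw, e2] at e1
    exact (congrArg ENNReal.toReal e1).ge
  -- If there were no Brownian motion in this universe, the bound would hold vacuously.
  · push Not at h
    refine ⟨1, 1, one_pos, one_pos, le_rfl, fun Ω _ P _ X hX hm => ?_⟩
    obtain ⟨t, ht⟩ := h Ω inferInstance P inferInstance X hX
    exact absurd (hm t) ht

section Steering

variable {Ω : Type*} {X : ℝ≥0 → Ω → ℝ}

/-- The σ-algebra generated by the process `X` up to time `t`. -/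
abbrev past (X : ℝ≥0 → Ω → ℝ) (t : ℝ≥0) : MeasurableSpace Ω :=
  MeasurableSpace.comap (fun ω (s : Set.Iic t) => X s ω) MeasurableSpace.pi

lemma measurable_past {s t : ℝ≥0} (h : s ≤ t) : Measurable[past X t] (X s) :=
  (measurable_pi_apply (X := fun _ : Set.Iic t => ℝ) ⟨s, h⟩).comp
    (comap_measurable fun ω (s : Set.Iic t) => X s ω)

lemma past_mono {s t : ℝ≥0} (h : s ≤ t) : past X s ≤ past X t := by
  refine Measurable.comap_le ?_
  refine @measurable_pi_lambda _ _ _ (past X t) _ _ fun u => ?_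
  exact measurable_past (u.2.trans h)

variable [MeasurableSpace Ω] {P : Measure Ω}

lemma past_le (hm : ∀ t, Measurable (X t)) (t : ℝ≥0) : past X t ≤ ‹MeasurableSpace Ω› :=
  (measurable_pi_lambda (fun ω (s : Set.Iic t) => X s ω) fun s => hm s).comap_le

lemma isBrownianReal_rescaledIncrement (hX : IsBrownianReal X P) (t : ℝ≥0) {σ : ℝ≥0} (hσ : 0 < σ) :
    IsBrownianReal (fun u ω => rescaledIncrement (fun s => X s ω) t σ u) P := by
  simpa [rescaledIncrement] using (hX.shift t).smul (c := σ ^ 2) (pow_ne_zero _ hσ.ne')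

/-- Weak Markov property: the rescaled increment after time `t` is independent of the past. -/
lemma measureReal_past_inter (hX : IsBrownianReal X P) (t σ : ℝ≥0) {E : Set Ω}
    (hE : MeasurableSet[past X t] E) {S : Set (ℝ≥0 → ℝ)} (hS : MeasurableSet S) :
    P.real (E ∩ {ω | rescaledIncrement (fun s => X s ω) t σ ∈ S}) =
      P.real E * P.real {ω | rescaledIncrement (fun s => X s ω) t σ ∈ S} := by
  obtain ⟨F, hF, rfl⟩ := hE
  have hφ : Measurable fun (x : ℝ≥0 → ℝ) (u : ℝ≥0) => (σ : ℝ)⁻¹ * x (σ ^ 2 * u) :=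
    measurable_pi_lambda _ fun _ => (measurable_pi_apply _).const_mul _
  have h := (hX.indepFun_shift t).symm.measure_inter_preimage_eq_mul F _ hF (hφ hS)
  simp only [measureReal_def, ← ENNReal.toReal_mul]
  exact congrArg ENNReal.toReal h

/-- The path `x` is pushed towards the level `m` during the time interval `[t, t + σ ^ 2]`: it moves
by an amount between `σ` and `K * σ`, downwards if it starts above `m` and upwards otherwise, and
does not move by more than `K * σ` in between. -/
def SteeredTowards (K : ℝ) (x : ℝ≥0 → ℝ) (t σ : ℝ≥0) (m : ℝ) : Prop :=
  (m ≤ x t → rescaledIncrement x t σ ∈ dropPaths K) ∧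
    (x t < m → -rescaledIncrement x t σ ∈ dropPaths K)

lemma SteeredTowards.abs_sub_le {K : ℝ} {x : ℝ≥0 → ℝ} {t σ : ℝ≥0} {m : ℝ}
    (h : SteeredTowards K x t σ m) (hx : Continuous x) (hσ : 0 < σ) {v : ℝ≥0}
    (hv : t ≤ v) (hv' : v ≤ t + σ ^ 2) : |x v - x t| ≤ K * σ := by
  have hσ' : (0 : ℝ) < σ := hσ
  have hc : Continuous (rescaledIncrement x t σ) := by unfold rescaledIncrement; fun_prop
  have hu : (v - t) / σ ^ 2 ≤ 1 := by
    rw [div_le_one (by positivity)]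
    exact tsub_le_iff_left.2 hv'
  have key : |rescaledIncrement x t σ ((v - t) / σ ^ 2)| ≤ K := by
    rcases le_or_gt m (x t) with hm | hm
    · exact ((mem_dropPaths_iff hc).1 (h.1 hm)).2 _ hu
    · simpa using ((mem_dropPaths_iff hc.neg).1 (h.2 hm)).2 _ hu
  rw [rescaledIncrement, mul_div_cancel₀ _ (by positivity), add_tsub_cancel_of_le hv, abs_mul,
    abs_of_pos (by positivity : (0 : ℝ) < (σ : ℝ)⁻¹), inv_mul_le_iff₀ hσ'] at key
  linarith

lemma SteeredTowards.drop {K : ℝ} {x : ℝ≥0 → ℝ} {t σ : ℝ≥0} {m : ℝ}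
    (h : SteeredTowards K x t σ m) (hσ : 0 < σ) (hm : m ≤ x t) : x (t + σ ^ 2) - x t ≤ -σ := by
  have hσ' : (0 : ℝ) < σ := hσ
  have := (h.1 hm).1
  rw [rescaledIncrement, mul_one, inv_mul_le_iff₀ hσ'] at this
  linarith

lemma SteeredTowards.rise {K : ℝ} {x : ℝ≥0 → ℝ} {t σ : ℝ≥0} {m : ℝ}
    (h : SteeredTowards K x t σ m) (hσ : 0 < σ) (hm : x t < m) : σ ≤ x (t + σ ^ 2) - x t := by
  have hσ' : (0 : ℝ) < σ := hσ
  have := (h.2 hm).1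
  rw [Pi.neg_apply, neg_le_neg_iff, rescaledIncrement, mul_one, le_inv_mul_iff₀ hσ'] at this
  linarith

/-- The steering strategy: a Brownian motion is pushed towards prescribed levels `m j` during `n`
consecutive blocks with probability at least `p ^ n`, because by the weak Markov property and the
symmetry of Brownian motion each push has conditional probability at least `p`, whatever the past. -/
lemma exists_steered [IsProbabilityMeasure P] {K p : ℝ} (hp : 0 ≤ p)
    (hKp : ∀ Y : ℝ≥0 → Ω → ℝ, IsBrownianReal Y P → (∀ t, Measurable (Y t)) →
      p ≤ P.real {ω | (fun t => Y t ω) ∈ dropPaths K})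
    (hX : IsBrownianReal X P) (hm : ∀ t, Measurable (X t)) {t σ : ℕ → ℝ≥0} (hσ : ∀ j, 0 < σ j)
    (ht : ∀ j, t (j + 1) = t j + σ j ^ 2) (m : ℕ → ℝ) {E₀ : Set Ω}
    (hE₀ : MeasurableSet[past X (t 0)] E₀) (n : ℕ) :
    ∃ E ⊆ E₀, MeasurableSet[past X (t n)] E ∧ p ^ n * P.real E₀ ≤ P.real E ∧
      ∀ ω ∈ E, ∀ j < n, SteeredTowards K (fun s => X s ω) (t j) (σ j) (m j) := by
  induction n with
  | zero => exact ⟨E₀, subset_rfl, hE₀, by simp, by simp⟩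
  | succ n ih =>
    obtain ⟨E, hE₀, hE, hPE, hst⟩ := ih
    have hle : t n ≤ t (n + 1) := by rw [ht n]; exact le_self_add
    let W : ℝ≥0 → Ω → ℝ := fun u ω => rescaledIncrement (fun s => X s ω) (t n) (σ n) u
    have hW : IsBrownianReal W P := isBrownianReal_rescaledIncrement hX _ (hσ n)
    have hWm (u : ℝ≥0) : Measurable (W u) := ((hm _).sub (hm _)).const_mul _
    have hneg : MeasurableSet {x : ℝ≥0 → ℝ | -x ∈ dropPaths K} :=
      measurable_neg (measurableSet_dropPaths K)
    let U : Set Ω := {ω | m n ≤ X (t n) ω}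
    have hU : MeasurableSet[past X (t n)] U :=
      measurable_past (X := X) le_rfl measurableSet_Ici
    let A : Set Ω := (E ∩ U) ∩ {ω | rescaledIncrement (fun s => X s ω) (t n) (σ n) ∈ dropPaths K}
    let A' : Set Ω := (E \ U) ∩
      {ω | rescaledIncrement (fun s => X s ω) (t n) (σ n) ∈ {x : ℝ≥0 → ℝ | -x ∈ dropPaths K}}
    have hPA : p * P.real (E ∩ U) ≤ P.real A := by
      rw [measureReal_past_inter hX _ _ (hE.inter hU) (measurableSet_dropPaths K), mul_comm]
      exact mul_le_mul_of_nonneg_left (hKp W hW hWm) measureReal_nonneg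
    have hPA' : p * P.real (E \ U) ≤ P.real A' := by
      rw [measureReal_past_inter hX _ _ (hE.diff hU) hneg, mul_comm]
      exact mul_le_mul_of_nonneg_left (hKp (-W) hW.neg fun u => (hWm u).neg) measureReal_nonneg
    -- `dropPaths` only involves times in `[0, 1]`, so that events about the increment expressed by
    -- it depend on the path up to time `t (n + 1)` only.
    have hblock {S : Set (ℝ≥0 → ℝ)} (hS : ∀ g : ℝ≥0 → Ω → ℝ,
        (∀ u ≤ 1, Measurable[past X (t (n + 1))] (g u)) →
          MeasurableSet[past X (t (n + 1))] {ω | (fun u => g u ω) ∈ S}) :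
        MeasurableSet[past X (t (n + 1))]
          {ω | rescaledIncrement (fun s => X s ω) (t n) (σ n) ∈ S} := by
      refine hS W fun u hu => ?_
      refine Measurable.const_mul (Measurable.sub (measurable_past ?_) (measurable_past hle)) _
      rw [ht n]
      gcongr
      exact mul_le_of_le_one_right' hu
    have hdrop (g : ℝ≥0 → Ω → ℝ) (hg : ∀ u ≤ 1, Measurable[past X (t (n + 1))] (g u)) :
        MeasurableSet[past X (t (n + 1))] {ω | (fun u => g u ω) ∈ dropPaths K} := by
      have e : {ω | (fun u => g u ω) ∈ dropPaths K} = {ω | g 1 ω ≤ -1} ∩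
          ⋂ k, {ω | |g (min (TopologicalSpace.denseSeq ℝ≥0 k) 1) ω| ≤ K} := by
        ext ω; simp [dropPaths]
      rw [e]
      refine MeasurableSet.inter (hg 1 le_rfl measurableSet_Iic) (MeasurableSet.iInter fun k => ?_)
      exact (measurable_norm.comp (hg _ (min_le_right _ _))) measurableSet_Iic
    have hA : MeasurableSet[past X (t (n + 1))] A :=
      (past_mono hle _ (hE.inter hU)).inter (hblock hdrop)
    have hA' : MeasurableSet[past X (t (n + 1))] A' :=
      (past_mono hle _ (hE.diff hU)).inter
        (hblock fun g hg => hdrop (fun u ω => -g u ω) fun u hu => (hg u hu).neg)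
    refine ⟨A ∪ A', ?_, hA.union hA', ?_, ?_⟩
    · rintro ω (h | h)
      exacts [hE₀ h.1.1, hE₀ h.1.1]
    · have hd : Disjoint A A' := Set.disjoint_left.2 fun ω h h' => h'.1.2 h.1.2
      rw [measureReal_union hd (past_le hm _ _ hA')]
      have hs : P.real (E ∩ U) + P.real (E \ U) = P.real E :=
        measureReal_inter_add_sdiff (past_le hm _ _ hU)
      calc p ^ (n + 1) * P.real E₀ = p * (p ^ n * P.real E₀) := by ring
        _ ≤ p * P.real E := by gcongr
        _ = p * P.real (E ∩ U) + p * P.real (E \ U) := by rw [← hs]; ring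
        _ ≤ _ := add_le_add hPA hPA'
    · intro ω hω j hj
      rcases Nat.lt_succ_iff_lt_or_eq.1 hj with hj | rfl
      · rcases hω with h | h
        exacts [hst ω h.1.1 j hj, hst ω h.1.1 j hj]
      · rcases hω with h | h
        · exact ⟨fun _ => h.2, fun h' => absurd h.1.2 (not_le.2 h')⟩
        · exact ⟨fun h' => absurd h' h.1.2, fun _ => h.2⟩

end Steering

/-! ### Confinement of real Brownian motion and of the Ornstein-Uhlenbeck process -/

/-- A path steered towards the moving centre `c` stays in the tube of radius `ρ` around `c`, and is
in the inner half of the tube at the end of each block. The drift of the centre during a block is at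
most the guaranteed displacement `σ j`, so that it cannot undo the push towards the centre. -/
lemma abs_sub_le_of_steered {K : ℝ} {x c ρ : ℝ≥0 → ℝ} (hx : Continuous x) (hρ : Monotone ρ)
    {t σ : ℕ → ℝ≥0} (hσ : ∀ j, 0 < σ j) (ht : ∀ j, t (j + 1) = t j + σ j ^ 2)
    (hc : ∀ j, ∀ v, t j ≤ v → v ≤ t (j + 1) → |c v - c (t j)| ≤ σ j)
    (hKσ : ∀ j, (K + 1) * σ j ≤ ρ (t j) / 2) (h0 : |x (t 0) - c (t 0)| ≤ ρ (t 0) / 2) (n : ℕ)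
    (hst : ∀ j < n, SteeredTowards K x (t j) (σ j) (c (t j))) :
    |x (t n) - c (t n)| ≤ ρ (t n) / 2 ∧ ∀ v, t 0 ≤ v → v ≤ t n → |x v - c v| ≤ ρ v := by
  induction n with
  | zero =>
    refine ⟨h0, fun v hv hv' => ?_⟩
    obtain rfl : v = t 0 := le_antisymm hv' hv
    linarith [abs_nonneg (x (t 0) - c (t 0))]
  | succ n ih =>
    obtain ⟨ih, ih'⟩ := ih fun j hj => hst j (hj.trans n.lt_succ_self)
    have hs := hst n n.lt_succ_self
    have hle : t n ≤ t (n + 1) := by rw [ht n]; exact le_self_add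
    have hKn := hKσ n
    have hρn := hρ hle
    have hσn : (0 : ℝ) < σ n := hσ n
    refine ⟨?_, fun v hv hv' => ?_⟩
    · have hcn := abs_le.1 (hc n _ hle le_rfl)
      have hd := abs_le.1 (hs.abs_sub_le hx (hσ n) hle (ht n).le)
      have ih := abs_le.1 ih
      rw [abs_le]
      rcases le_or_gt (c (t n)) (x (t n)) with h | h
      · have := hs.drop (hσ n) h
        rw [← ht n] at this
        constructor <;> linarith
      · have := hs.rise (hσ n) h
        rw [← ht n] at this
        constructor <;> linarith
    · rcases le_total v (t n) with h | h
      · exact ih' v hv h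
      · have hcn := abs_le.1 (hc n v h hv')
        have hd := abs_le.1 (hs.abs_sub_le hx (hσ n) h (hv'.trans (ht n).le))
        have hρv := hρ h
        have ih := abs_le.1 ih
        rw [abs_le]
        constructor <;> linarith

lemma tube_probability {Ω : Type*} [MeasurableSpace Ω] {P : Measure Ω} [IsProbabilityMeasure P]
    {X : ℝ≥0 → Ω → ℝ} {K p : ℝ} (hp : 0 ≤ p)
    (hKp : ∀ Y : ℝ≥0 → Ω → ℝ, IsBrownianReal Y P → (∀ t, Measurable (Y t)) →
      p ≤ P.real {ω | (fun t => Y t ω) ∈ dropPaths K})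
    (hX : IsBrownianReal X P) (hm : ∀ t, Measurable (X t)) {c ρ : ℝ≥0 → ℝ} (hρ : Monotone ρ)
    {t σ : ℕ → ℝ≥0} (hσ : ∀ j, 0 < σ j) (ht : ∀ j, t (j + 1) = t j + σ j ^ 2)
    (hc : ∀ j, ∀ v, t j ≤ v → v ≤ t (j + 1) → |c v - c (t j)| ≤ σ j)
    (hKσ : ∀ j, (K + 1) * σ j ≤ ρ (t j) / 2) (n : ℕ) :
    p ^ n * P.real {ω | |X (t 0) ω - c (t 0)| ≤ ρ (t 0) / 2} ≤
      P.real {ω | ∀ v, t 0 ≤ v → v ≤ t n → |X v ω - c v| ≤ ρ v} := by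
  have hE₀ : MeasurableSet[past X (t 0)] {ω | |X (t 0) ω - c (t 0)| ≤ ρ (t 0) / 2} :=
    measurable_past (X := X) le_rfl
      (measurableSet_le (by fun_prop) measurable_const :
        MeasurableSet {y : ℝ | |y - c (t 0)| ≤ ρ (t 0) / 2})
  obtain ⟨E, hE, -, hPE, hst⟩ :=
    exists_steered hp hKp hX hm hσ ht (fun j => c (t j)) hE₀ n
  refine hPE.trans (ENNReal.toReal_mono (measure_ne_top _ _) (measure_mono_ae ?_))
  filter_upwards [hX.cont] with ω hω hωE
  exact (abs_sub_le_of_steered hω hρ hσ ht hc hKσ (hE hωE) n (hst ω hωE)).2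

lemma exp_neg_le_pow {p y : ℝ} (hp : 0 < p) (hp1 : p ≤ 1) {n : ℕ} (hn : (n : ℝ) ≤ y) :
    Real.exp (-(-Real.log p * y)) ≤ p ^ n := by
  rw [← Real.exp_log (pow_pos hp n), Real.log_pow, Real.exp_le_exp]
  have := Real.log_nonpos hp.le hp1
  nlinarith

/-- Real Brownian motion stays in `[-r, r]` up to time `T` with probability at least
`exp (-L (T / r ^ 2 + 1))`, for an absolute constant `L`. -/
theorem exists_brownian_confinement : ∃ L : ℝ, 0 < L ∧
    ∀ (Ω : Type*) [MeasurableSpace Ω] (P : Measure Ω) [IsProbabilityMeasure P] (X : ℝ≥0 → Ω → ℝ),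
      IsBrownianReal X P → (∀ t, Measurable (X t)) → ∀ r : ℝ, 0 < r → ∀ T : ℝ≥0,
        Real.exp (-(L * (T / r ^ 2 + 1))) ≤
          P.real {ω | (fun t => X t ω) ∈ confinedPaths T 0 r} := by
  obtain ⟨K, p, hK, hp, hp1, hKp⟩ := exists_dropPaths_bound
  have hlog := Real.log_nonpos hp.le hp1
  refine ⟨-Real.log p * (4 * (K + 1) ^ 2 + 1) + 1, by
    have : 0 ≤ -Real.log p * (4 * (K + 1) ^ 2 + 1) := mul_nonneg (by linarith) (by positivity)
    linarith, ?_⟩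
  intro Ω _ P _ X hX hm r hr T
  let σ : ℝ≥0 := ⟨r / (2 * (K + 1)), by positivity⟩
  have hσr : (σ : ℝ) = r / (2 * (K + 1)) := rfl
  have hσ : 0 < σ := by
    rw [← NNReal.coe_pos, hσr]; positivity
  let n : ℕ := ⌈(T : ℝ) / σ ^ 2⌉₊
  have hn : (n : ℝ) ≤ T / σ ^ 2 + 1 := (Nat.ceil_lt_add_one (by positivity)).le
  have hTn : T ≤ n * σ ^ 2 := by
    rw [← NNReal.coe_le_coe]
    push_cast
    rw [← div_le_iff₀ (by positivity)]
    exact Nat.le_ceil _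
  have key := tube_probability hp.le (fun Y hY hYm => hKp Ω P Y hY hYm) hX hm (c := fun _ => 0)
    (ρ := fun _ => r) monotone_const (t := fun j => j * σ ^ 2) (σ := fun _ => σ) (fun _ => hσ)
    (fun j => by push_cast; ring) (fun j v _ _ => by simp)
    (fun j => by rw [hσr]; field_simp; rfl) n
  have h0 : P.real {ω | |X (((0 : ℕ) : ℝ≥0) * σ ^ 2) ω - 0| ≤ r / 2} = 1 := by
    refine (measureReal_congr (eventuallyEq_univ.2 ?_)).trans probReal_univ
    filter_upwards [hX.eval_zero_ae_eq_zero] with ω hω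
    simp only [Nat.cast_zero, zero_mul, hω, sub_zero, abs_zero]
    positivity
  rw [h0, mul_one] at key
  refine le_trans ?_ (key.trans (measureReal_mono fun ω hω k => ?_))
  · refine le_trans ?_ (exp_neg_le_pow hp hp1 hn)
    rw [Real.exp_le_exp, neg_le_neg_iff, hσr]
    have hT : 0 ≤ (T : ℝ) / r ^ 2 := by positivity
    have e : (T : ℝ) / (r / (2 * (K + 1))) ^ 2 = 4 * (K + 1) ^ 2 * (T / r ^ 2) := by
      field_simp; norm_num
    rw [e]
    have h2 : 0 ≤ -Real.log p * (T / r ^ 2) := mul_nonneg (by linarith) hT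
    have h3 : 0 ≤ -Real.log p * (4 * (K + 1) ^ 2) := mul_nonneg (by linarith) (by positivity)
    nlinarith
  · exact hω _ (by simp) ((min_le_right _ _).trans hTn)

/-- The real Ornstein-Uhlenbeck path driven by the path `x`. -/
noncomputable def ouPath (x : ℝ≥0 → ℝ) (t : ℝ≥0) : ℝ :=
  Real.exp (-(t : ℝ) / 2) * x (Real.exp (t : ℝ)).toNNReal

lemma measurable_ouPath : Measurable ouPath :=
  measurable_pi_lambda _ fun _ => (measurable_pi_apply _).const_mul _

/-- The stationary Ornstein-Uhlenbeck process stays within `ρ` of `m` up to time `T` with probability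
decaying at most at the exponential rate `L (1 + m ^ 2)`, where `L` depends only on `ρ`. The block
length in the proof is of order `1 / (1 + m ^ 2)`: over such a time the drift towards `0`, of order
`|m| / (1 + m ^ 2)`, does not exceed the fluctuations, of order `1 / (1 + |m|)`. -/
theorem exists_ornsteinUhlenbeck_confinement {ρ : ℝ} (hρ : 0 < ρ) : ∃ L : ℝ, 0 < L ∧
    ∀ (Ω : Type*) [MeasurableSpace Ω] (P : Measure Ω) [IsProbabilityMeasure P] (X : ℝ≥0 → Ω → ℝ),
      IsBrownianReal X P → (∀ t, Measurable (X t)) → ∀ m : ℝ, ∃ q : ℝ, 0 < q ∧ ∀ T : ℝ≥0,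
        q * Real.exp (-(L * (1 + m ^ 2) * T)) ≤
          P.real {ω | ouPath (fun t => X t ω) ∈ confinedPaths T m ρ} := by
  obtain ⟨K, p, hK, hp, hp1, hKp⟩ := exists_dropPaths_bound
  have hlog := Real.log_nonpos hp.le hp1
  let A : ℝ := max 1 (2 * (K + 1) / ρ)
  have hA1 : 1 ≤ A := le_max_left _ _
  have hA2 : 2 * (K + 1) / ρ ≤ A := le_max_right _ _
  refine ⟨4 * -Real.log p * A ^ 2 + 1, by
    have : 0 ≤ 4 * -Real.log p * A ^ 2 := mul_nonneg (by linarith) (by positivity)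
    linarith, ?_⟩
  intro Ω _ P _ X hX hm m
  have hD : 0 < A * (1 + |m|) := by positivity
  let s : ℝ≥0 := ⟨1 / (A * (1 + |m|)), by positivity⟩
  have hsr : (s : ℝ) = 1 / (A * (1 + |m|)) := rfl
  have hs : (0 : ℝ) < s := by rw [hsr]; positivity
  have hsm : |m| * s ≤ 1 := by
    rw [hsr, mul_one_div, div_le_one hD]
    nlinarith [abs_nonneg m]
  have hs1 : (s : ℝ) ≤ 1 := by
    rw [hsr, div_le_one hD]
    nlinarith [abs_nonneg m]
  have hsK : (K + 1) * s ≤ ρ / 2 := by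
    rw [div_le_iff₀ hρ] at hA2
    rw [hsr, mul_one_div, div_le_iff₀ hD]
    have : A ≤ A * (1 + |m|) := le_mul_of_one_le_right (by positivity) (by simp)
    nlinarith
  let b : ℝ≥0 := NNReal.sqrt (1 + s ^ 2)
  have hb2 : b ^ 2 = 1 + s ^ 2 := NNReal.sq_sqrt _
  have hb2' : (b : ℝ) ^ 2 = 1 + (s : ℝ) ^ 2 := by exact_mod_cast congrArg NNReal.toReal hb2
  have hb1 : (1 : ℝ) ≤ b := by
    by_contra! h
    nlinarith [b.coe_nonneg]
  have hb : 0 < b := by rw [← NNReal.coe_pos]; linarith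
  have hbs : |m| * ((b : ℝ) - 1) ≤ s := by
    have h1 : (b : ℝ) - 1 ≤ s ^ 2 := by nlinarith
    calc |m| * ((b : ℝ) - 1) ≤ |m| * s ^ 2 := by gcongr
      _ = (|m| * s) * s := by ring
      _ ≤ 1 * s := by gcongr
      _ = s := one_mul _
  let q₀ := P.real {ω | |X 1 ω - m| ≤ ρ / 2}
  have hq₀ : 0 < q₀ := by
    refine ENNReal.toReal_pos ?_ (measure_ne_top _ _)
    rw [(hX.hasLaw_eval 1).measure_eq (p := fun y => |y - m| ≤ ρ / 2)
      (measurableSet_le (by fun_prop) measurable_const)]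
    intro h0
    have h2 := gaussianReal_absolutelyContinuous' 0 (v := 1) one_ne_zero h0
    have h3 : {y : ℝ | |y - m| ≤ ρ / 2} = Metric.closedBall m (ρ / 2) := by
      ext y; simp [Real.dist_eq]
    rw [h3, Real.volume_closedBall, ENNReal.ofReal_eq_zero] at h2
    linarith
  refine ⟨p * q₀, mul_pos hp hq₀, fun T => ?_⟩
  have hh : (s : ℝ) ^ 2 / 2 ≤ Real.log (1 + (s : ℝ) ^ 2) := by
    refine le_trans ?_ (Real.one_sub_inv_le_log_of_pos (by positivity))
    have h1 : (s : ℝ) ^ 2 ≤ 1 := pow_le_one₀ hs.le hs1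
    rw [div_le_iff₀ two_pos, ← sub_nonneg]
    have : (1 - (1 + (s : ℝ) ^ 2)⁻¹) * 2 - (s : ℝ) ^ 2 =
        (s : ℝ) ^ 2 * (1 - (s : ℝ) ^ 2) / (1 + (s : ℝ) ^ 2) := by
      field_simp; ring
    rw [this]
    exact div_nonneg (mul_nonneg (by positivity) (by linarith)) (by positivity)
  have hh0 : 0 < Real.log (1 + (s : ℝ) ^ 2) := lt_of_lt_of_le (by positivity) hh
  let n : ℕ := ⌈(T : ℝ) / Real.log (1 + (s : ℝ) ^ 2)⌉₊
  have hn : (n : ℝ) ≤ T / (s ^ 2 / 2) + 1 := by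
    refine (Nat.ceil_lt_add_one (by positivity)).le.trans ?_
    gcongr
  have hTn : Real.exp T ≤ ((b ^ n : ℝ≥0) : ℝ) ^ 2 := by
    have h1 : (T : ℝ) ≤ n * Real.log (1 + (s : ℝ) ^ 2) := by
      rw [← div_le_iff₀ hh0]; exact Nat.le_ceil _
    calc Real.exp T ≤ Real.exp (n * Real.log (1 + (s : ℝ) ^ 2)) := Real.exp_le_exp.2 h1
      _ = (1 + (s : ℝ) ^ 2) ^ n := by
        rw [← Real.log_pow, Real.exp_log (by positivity)]
      _ = _ := by rw [← hb2']; push_cast; ring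
  have key := tube_probability hp.le (fun Y hY hYm => hKp Ω P Y hY hYm) hX hm
    (c := fun v => m * √(v : ℝ)) (ρ := fun v => ρ * √(v : ℝ))
    (fun v w h => by dsimp only; gcongr) (t := fun j => (b ^ j) ^ 2) (σ := fun j => s * b ^ j)
    (fun j => mul_pos hs (pow_pos hb j))
    (fun j => by rw [pow_succ b, mul_pow, hb2]; ring)
    (fun j v hv hv' => by
      have h1 : ((b ^ j : ℝ≥0) : ℝ) ≤ √(v : ℝ) := Real.le_sqrt_of_sq_le (by exact_mod_cast hv)
      have h2 : √(v : ℝ) ≤ ((b ^ (j + 1) : ℝ≥0) : ℝ) :=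

        (Real.sqrt_le_iff.2 ⟨NNReal.coe_nonneg _, by exact_mod_cast hv'⟩)
      have h3 : √(((b ^ j) ^ 2 : ℝ≥0) : ℝ) = ((b ^ j : ℝ≥0) : ℝ) := by
        rw [NNReal.coe_pow, Real.sqrt_sq (NNReal.coe_nonneg _)]
      rw [h3, ← mul_sub, abs_mul, abs_of_nonneg (sub_nonneg.2 h1)]
      push_cast at h1 h2 ⊢
      calc |m| * (√(v : ℝ) - b ^ j) ≤ |m| * (b ^ (j + 1) - b ^ j) := by gcongr
        _ = (|m| * (b - 1)) * b ^ j := by ring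
        _ ≤ s * b ^ j := by gcongr)
    (fun j => by
      rw [NNReal.coe_pow, Real.sqrt_sq (NNReal.coe_nonneg _)]
      push_cast
      calc (K + 1) * (s * b ^ j) = ((K + 1) * s) * (b : ℝ) ^ j := by ring
        _ ≤ ρ / 2 * b ^ j := by gcongr
        _ = ρ * b ^ j / 2 := by ring) n
  simp only [pow_zero, one_pow, NNReal.coe_one, Real.sqrt_one, mul_one] at key
  refine le_trans ?_ (key.trans (measureReal_mono fun ω hω k => ?_))
  · have hpn := exp_neg_le_pow hp hp1 hn
    calc p * q₀ * Real.exp (-((4 * -Real.log p * A ^ 2 + 1) * (1 + m ^ 2) * T))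
        ≤ p * q₀ * Real.exp (-(-Real.log p * (T / (s ^ 2 / 2)))) := by
          refine mul_le_mul_of_nonneg_left (Real.exp_le_exp.2 (neg_le_neg ?_)) (by positivity)
          have e : (T : ℝ) / (s ^ 2 / 2) = 2 * A ^ 2 * (1 + |m|) ^ 2 * T := by
            rw [hsr]; field_simp
          rw [e]
          have h1 : (1 + |m|) ^ 2 ≤ 2 * (1 + m ^ 2) := by
            nlinarith [sq_abs m, sq_nonneg (1 - |m|)]
          have h2 : 0 ≤ -Real.log p := by linarith
          calc -Real.log p * (2 * A ^ 2 * (1 + |m|) ^ 2 * T)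
              ≤ -Real.log p * (2 * A ^ 2 * (2 * (1 + m ^ 2)) * T) := by gcongr
            _ ≤ -Real.log p * (2 * A ^ 2 * (2 * (1 + m ^ 2)) * T) + (1 + m ^ 2) * T :=
              le_add_of_nonneg_right (by positivity)
            _ = _ := by ring
      _ = Real.exp (-(-Real.log p * (T / (s ^ 2 / 2) + 1))) * q₀ := by
          rw [show -(-Real.log p * ((T : ℝ) / (s ^ 2 / 2) + 1)) =
            Real.log p + -(-Real.log p * (T / (s ^ 2 / 2))) by ring, Real.exp_add, Real.exp_log hp]
          ring
      _ ≤ p ^ n * q₀ := by gcongr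
  · set u := min (TopologicalSpace.denseSeq ℝ≥0 k) T with hu
    have huT : u ≤ T := min_le_right _ _
    have he : ((Real.exp u).toNNReal : ℝ) = Real.exp u := Real.coe_toNNReal _ (Real.exp_pos _).le
    have h1 : 1 ≤ (Real.exp u).toNNReal := by
      rw [← NNReal.coe_le_coe, he]; exact Real.one_le_exp u.2
    have h2 : (Real.exp u).toNNReal ≤ (b ^ n) ^ 2 := by
      rw [← NNReal.coe_le_coe, he]
      exact (Real.exp_le_exp.2 (by exact_mod_cast huT)).trans (by exact_mod_cast hTn)
    have h3 := hω _ h1 h2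
    rw [he, ← Real.exp_half] at h3
    have h4 : Real.exp (-(u : ℝ) / 2) * Real.exp ((u : ℝ) / 2) = 1 := by
      rw [← Real.exp_add]; ring_nf; exact Real.exp_zero
    calc |ouPath (fun t => X t ω) u - m|
        = |Real.exp (-(u : ℝ) / 2) *
            (X (Real.exp u).toNNReal ω - m * Real.exp ((u : ℝ) / 2))| := by
          congr 1
          rw [ouPath, mul_sub, mul_left_comm, h4, mul_one]
      _ ≤ Real.exp (-(u : ℝ) / 2) * (ρ * Real.exp ((u : ℝ) / 2)) := by
          rw [abs_mul, abs_of_pos (Real.exp_pos _)]; gcongr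
      _ = ρ := by rw [mul_left_comm, h4, mul_one]

/-! ### From exponential lower bounds to rates -/

lemma neg_le_lowerRate {Ω : Type*} [MeasurableSpace Ω] {P : Measure Ω} [IsProbabilityMeasure P]
    {E : ℝ≥0 → Set Ω} {q l : ℝ} (hq : 0 < q)
    (h : ∀ T : ℝ≥0, q * Real.exp (-(l * T)) ≤ P.real (E T)) :
    ((-l : ℝ) : EReal) ≤ lowerRate P E := by
  have hlim : Tendsto (fun T : ℝ≥0 => ((1 / (T : ℝ) * Real.log q - l : ℝ) : EReal)) atTop
      (nhds ((-l : ℝ) : EReal)) := by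
    refine (continuous_coe_real_ereal.tendsto _).comp ?_
    have h1 : Tendsto (fun T : ℝ≥0 => 1 / (T : ℝ)) atTop (nhds 0) := by
      simp only [one_div]
      exact tendsto_inv_atTop_zero.comp (NNReal.tendsto_coe_atTop.2 tendsto_id)
    simpa using (h1.mul_const (Real.log q)).sub_const l
  rw [← hlim.liminf_eq]
  refine liminf_le_liminf ?_
  filter_upwards [eventually_gt_atTop 0] with T hT
  have hT' : (0 : ℝ) < T := hT
  have hpos : 0 < q * Real.exp (-(l * T)) := by positivity
  have h2 : ((Real.log q - l * T : ℝ) : EReal) ≤ ENNReal.log (P (E T)) := by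
    have h3 : ENNReal.ofReal (q * Real.exp (-(l * T))) ≤ P (E T) := by
      rw [← ofReal_measureReal]
      exact ENNReal.ofReal_le_ofReal (h T)
    refine le_trans ?_ (ENNReal.log_monotone h3)
    rw [ENNReal.log_ofReal_of_pos hpos, Real.log_mul hq.ne' (Real.exp_pos _).ne', Real.log_exp]
    exact le_of_eq (by rw [sub_eq_add_neg])
  calc ((1 / (T : ℝ) * Real.log q - l : ℝ) : EReal)
      = ((1 / (T : ℝ) : ℝ) : EReal) * ((Real.log q - l * T : ℝ) : EReal) := by
        rw [← EReal.coe_mul]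
        congr 1
        field_simp
    _ ≤ _ := mul_le_mul_of_nonneg_left h2 (by exact_mod_cast (by positivity : 0 ≤ 1 / (T : ℝ)))

lemma le_pointCount {ι Ω : Type*} {Z : ι → Ω → ℂ} {A : Set ℂ} {ω : Ω} {S : Finset ι}
    (h : ∀ i ∈ S, Z i ω ∈ A) : (S.card : ℕ∞) ≤ pointCount Z A ω := by
  rw [← Set.encard_coe_eq_coe_finsetCard]
  exact Set.encard_le_encard h

/-! ### Confinement of complex processes -/

/-- Complex paths whose real and imaginary parts, multiplied by `√2`, stay within `ρ` of those of
`√2 * w` during `[0, T]`: the path stays in a square inscribed in the disk of centre `w` and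
radius `ρ`. -/
def squarePaths (T : ℝ≥0) (w : ℂ) (ρ : ℝ) : Set (ℝ≥0 → ℂ) :=
  {z | (fun t => √2 * (z t).re) ∈ confinedPaths T (√2 * w.re) ρ ∧
    (fun t => √2 * (z t).im) ∈ confinedPaths T (√2 * w.im) ρ}

lemma measurable_scaledRe : Measurable fun (z : ℝ≥0 → ℂ) (t : ℝ≥0) => √2 * (z t).re :=
  measurable_pi_lambda _ fun t => (Complex.measurable_re.comp (measurable_pi_apply t)).const_mul _

lemma measurable_scaledIm : Measurable fun (z : ℝ≥0 → ℂ) (t : ℝ≥0) => √2 * (z t).im :=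
  measurable_pi_lambda _ fun t => (Complex.measurable_im.comp (measurable_pi_apply t)).const_mul _

lemma measurableSet_squarePaths (T : ℝ≥0) (w : ℂ) (ρ : ℝ) : MeasurableSet (squarePaths T w ρ) :=
  (measurable_scaledRe (measurableSet_confinedPaths T _ ρ)).inter
    (measurable_scaledIm (measurableSet_confinedPaths T _ ρ))

lemma norm_sub_le_of_mem_squarePaths {T : ℝ≥0} {w : ℂ} {ρ : ℝ} (hρ : 0 ≤ ρ) {z : ℝ≥0 → ℂ}
    (hz : Continuous z) (h : z ∈ squarePaths T w ρ) {t : ℝ≥0} (ht : t ≤ T) : ‖z t - w‖ ≤ ρ := by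
  have h1 := (mem_confinedPaths_iff (by fun_prop)).1 h.1 t ht
  have h2 := (mem_confinedPaths_iff (by fun_prop)).1 h.2 t ht
  rw [← mul_sub] at h1 h2
  have h1' := sq_le_sq' (abs_le.1 h1).1 (abs_le.1 h1).2
  have h2' := sq_le_sq' (abs_le.1 h2).1 (abs_le.1 h2).2
  rw [mul_pow, Real.sq_sqrt zero_le_two] at h1' h2'
  refine abs_le_of_sq_le_sq' ?_ hρ |>.2
  rw [Complex.sq_norm, Complex.normSq_apply, Complex.sub_re, Complex.sub_im]
  nlinarith

/-- The complex Ornstein-Uhlenbeck path driven by the path `z`. -/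
noncomputable def complexOuPath (z : ℝ≥0 → ℂ) (t : ℝ≥0) : ℂ :=
  (Real.exp (-(t : ℝ) / 2) : ℂ) * z (Real.exp (t : ℝ)).toNNReal

lemma measurable_complexOuPath : Measurable complexOuPath :=
  measurable_pi_lambda _ fun _ => (measurable_pi_apply _).const_mul _

lemma continuous_complexOuPath {z : ℝ≥0 → ℂ} (hz : Continuous z) :
    Continuous (complexOuPath z) := by
  unfold complexOuPath
  fun_prop

lemma scaledRe_complexOuPath (z : ℝ≥0 → ℂ) :
    (fun t => √2 * (complexOuPath z t).re) = ouPath fun t => √2 * (z t).re := by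
  ext t
  rw [complexOuPath, Complex.re_ofReal_mul, ouPath]
  ring

lemma scaledIm_complexOuPath (z : ℝ≥0 → ℂ) :
    (fun t => √2 * (complexOuPath z t).im) = ouPath fun t => √2 * (z t).im := by
  ext t
  rw [complexOuPath, Complex.im_ofReal_mul, ouPath]
  ring

section ComplexBrownian

variable {Ω : Type*} [MeasurableSpace Ω] {P : Measure Ω}

lemma IsComplexBrownian.ae_continuous {B : ℝ≥0 → Ω → ℂ} (hB : IsComplexBrownian B P) :
    ∀ᵐ ω ∂P, Continuous fun t => B t ω := by
  filter_upwards [hB.re.cont, hB.im.cont] with ω h1 h2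
  have h2' : (√2 : ℝ) ≠ 0 := by positivity
  have h3 : Continuous fun t => (B t ω).re := by
    simpa [h2'] using h1.const_mul (√2)⁻¹
  have h4 : Continuous fun t => (B t ω).im := by
    simpa [h2'] using h2.const_mul (√2)⁻¹
  have h5 : (fun t => B t ω) = fun t => (((B t ω).re : ℂ) + (B t ω).im * Complex.I) := by
    ext t; exact (Complex.re_add_im _).symm
  rw [h5]
  fun_prop

lemma IsComplexBrownian.measurable_re {B : ℝ≥0 → Ω → ℂ} (hB : IsComplexBrownian B P) (t : ℝ≥0) :
    Measurable fun ω => √2 * (B t ω).re :=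
  (Complex.measurable_re.comp (hB.measurable t)).const_mul _

lemma IsComplexBrownian.measurable_im {B : ℝ≥0 → Ω → ℂ} (hB : IsComplexBrownian B P) (t : ℝ≥0) :
    Measurable fun ω => √2 * (B t ω).im :=
  (Complex.measurable_im.comp (hB.measurable t)).const_mul _

lemma IsComplexBrownian.measureReal_re_im {B : ℝ≥0 → Ω → ℂ} (hB : IsComplexBrownian B P)
    {S S' : Set (ℝ≥0 → ℝ)} (hS : MeasurableSet S) (hS' : MeasurableSet S') :
    P.real {ω | (fun t => √2 * (B t ω).re) ∈ S ∧ (fun t => √2 * (B t ω).im) ∈ S'} =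
      P.real {ω | (fun t => √2 * (B t ω).re) ∈ S} *
        P.real {ω | (fun t => √2 * (B t ω).im) ∈ S'} := by
  have hφ : Measurable fun (x : ℝ≥0 → ℝ) (t : ℝ≥0) => √2 * x t :=
    measurable_pi_lambda _ fun _ => (measurable_pi_apply _).const_mul _
  have h := hB.indep.measure_inter_preimage_eq_mul _ _ (hφ hS) (hφ hS')
  simp only [measureReal_def, ← ENNReal.toReal_mul]
  exact congrArg ENNReal.toReal h

lemma IsBrownianFamily.measureReal_forall {ι : Type*} {B : ι → ℝ≥0 → Ω → ℂ}
    (hB : IsBrownianFamily B P) (S : Finset ι) {D : ι → Set (ℝ≥0 → ℂ)}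
    (hD : ∀ i, MeasurableSet (D i)) :
    P.real {ω | ∀ i ∈ S, (fun t => B i t ω) ∈ D i} =
      ∏ i ∈ S, P.real {ω | (fun t => B i t ω) ∈ D i} := by
  have h := hB.indep.measure_inter_preimage_eq_mul S (sets := D) fun i _ => hD i
  simp only [measureReal_def, ← ENNReal.toReal_prod]
  refine congrArg ENNReal.toReal (Eq.trans ?_ h)
  congr 1
  ext ω
  simp

end ComplexBrownian

/-! ### The Brownian Poisson model -/

/-- With positive probability, `N` points with prescribed indices of a Poisson process lie in a
given set of positive finite intensity. -/
lemma IsPoissonProcess.exists_finset {Ω : Type*} [MeasurableSpace Ω] {P : Measure Ω}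
    [IsProbabilityMeasure P] {Z : ℕ → Ω → ℂ} {Λ : Measure ℂ} (hZ : IsPoissonProcess Z Λ P)
    {A : Set ℂ} (hA : MeasurableSet A) (h0 : Λ A ≠ 0) (hfin : Λ A ≠ ∞) (N : ℕ) :
    ∃ S : Finset ℕ, S.card = N ∧ 0 < P.real {ω | ∀ i ∈ S, Z i ω ∈ A} := by
  by_contra! h
  have hnull : P (⋃ S : {S : Finset ℕ // S.card = N}, {ω | ∀ i ∈ S.1, Z i ω ∈ A}) = 0 := by
    refine measure_iUnion_null fun S => ?_
    exact (measureReal_eq_zero_iff).1 (le_antisymm (h S.1 S.2) measureReal_nonneg)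
  have hsub : {ω | pointCount Z A ω = N} ⊆
      ⋃ S : {S : Finset ℕ // S.card = N}, {ω | ∀ i ∈ S.1, Z i ω ∈ A} := by
    intro ω (hω : {i | Z i ω ∈ A}.encard = N)
    have hf : {i | Z i ω ∈ A}.Finite := Set.finite_of_encard_eq_coe hω
    refine Set.mem_iUnion.2 ⟨⟨hf.toFinset, ?_⟩, fun i hi => by simpa using hi⟩
    rw [hf.encard_eq_coe_toFinset_card] at hω
    exact_mod_cast hω
  have h1 := hZ.law A hA hfin N
  rw [measure_mono_null hsub hnull] at h1
  have h2 := poissonMeasure_real_singleton_pos N (ENNReal.toNNReal_pos h0 hfin)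
  rw [measureReal_def, ← h1] at h2
  simp at h2

theorem exists_poisson_rate : ∃ C : ℝ, 0 < C ∧
    ∀ (Ω : Type*) [MeasurableSpace Ω] (P : Measure Ω) [IsProbabilityMeasure P]
      (Z : ℕ → Ω → ℂ) (B : ℕ → ℝ≥0 → Ω → ℂ), IsBrownianPoisson Z B P →
      ∀ R : ℝ, 0 < R → ∀ N : ℕ,
        ((-(C * N / R ^ 2) : ℝ) : EReal) ≤
          lowerRate P (fun T => overcrowding (poissonPoint Z B) T R N) := by
  obtain ⟨L, hL, h⟩ := exists_brownian_confinement
  refine ⟨8 * L, by positivity, fun Ω _ P _ Z B hZB R hR N => ?_⟩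
  have hdisk : disk (R / 2) = Metric.closedBall 0 (R / 2) := by ext; simp [disk]
  have hmd : MeasurableSet (disk (R / 2)) := hdisk ▸ measurableSet_closedBall
  have hvol0 : (volume : Measure ℂ) (disk (R / 2)) ≠ 0 := by
    rw [hdisk]
    exact (Metric.measure_closedBall_pos _ _ (by positivity)).ne'
  have hvol : (volume : Measure ℂ) (disk (R / 2)) ≠ ∞ := by
    rw [hdisk]
    exact measure_closedBall_lt_top.ne
  obtain ⟨S, hSN, hS⟩ := hZB.poisson.exists_finset hmd
    (by
      rw [Measure.smul_apply, smul_eq_mul]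
      exact mul_ne_zero (ENNReal.ofReal_pos.2 (by positivity)).ne' hvol0)
    (by
      rw [Measure.smul_apply, smul_eq_mul]
      exact ENNReal.mul_ne_top ENNReal.ofReal_ne_top hvol) N
  set q₀ := P.real {ω | ∀ i ∈ S, Z i ω ∈ disk (R / 2)}
  refine neg_le_lowerRate (q := q₀ * Real.exp (-(2 * L * N))) (by positivity) fun T => ?_
  let D : Set (ℝ≥0 → ℂ) := squarePaths T 0 (R / 2)
  have hD : MeasurableSet D := measurableSet_squarePaths _ _ _
  have hBi (i : ℕ) : Real.exp (-(2 * (L * (T / (R / 2) ^ 2 + 1)))) ≤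
      P.real {ω | (fun t => B i t ω) ∈ D} := by
    have hb := hZB.brownian.brownian i
    have hre := h Ω P _ hb.re hb.measurable_re (R / 2) (by positivity) T
    have him := h Ω P _ hb.im hb.measurable_im (R / 2) (by positivity) T
    have hprod := hb.measureReal_re_im (measurableSet_confinedPaths T 0 (R / 2))
      (measurableSet_confinedPaths T 0 (R / 2))
    have e : {ω | (fun t => B i t ω) ∈ D} =
        {ω | (fun t => √2 * (B i t ω).re) ∈ confinedPaths T 0 (R / 2) ∧
          (fun t => √2 * (B i t ω).im) ∈ confinedPaths T 0 (R / 2)} := by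
      ext ω; simp [D, squarePaths]
    rw [e, hprod, two_mul, neg_add, Real.exp_add]
    exact mul_le_mul hre him (Real.exp_pos _).le measureReal_nonneg
  have hall : Real.exp (-(2 * (L * (T / (R / 2) ^ 2 + 1)))) ^ N ≤
      P.real {ω | ∀ i ∈ S, (fun t => B i t ω) ∈ D} := by
    rw [hZB.brownian.measureReal_forall S (D := fun _ => D) fun _ => hD, ← hSN, ← Finset.prod_const]
    exact Finset.prod_le_prod (fun _ _ => (Real.exp_pos _).le) fun i _ => hBi i
  have hind : P.real ({ω | ∀ i ∈ S, Z i ω ∈ disk (R / 2)} ∩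
      {ω | ∀ i ∈ S, (fun t => B i t ω) ∈ D}) =
        q₀ * P.real {ω | ∀ i ∈ S, (fun t => B i t ω) ∈ D} := by
    have hm1 : MeasurableSet {x : ℕ → ℂ | ∀ i ∈ S, x i ∈ disk (R / 2)} := by
      have e : {x : ℕ → ℂ | ∀ i ∈ S, x i ∈ disk (R / 2)} =
          ⋂ i ∈ S, (fun x : ℕ → ℂ => x i) ⁻¹' disk (R / 2) := by ext; simp
      rw [e]
      exact Finset.measurableSet_biInter _ fun i _ => measurable_pi_apply i hmd
    have hm2 : MeasurableSet {b : ℕ → ℝ≥0 → ℂ | ∀ i ∈ S, b i ∈ D} := by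
      have e : {b : ℕ → ℝ≥0 → ℂ | ∀ i ∈ S, b i ∈ D} =
          ⋂ i ∈ S, (fun b : ℕ → ℝ≥0 → ℂ => b i) ⁻¹' D := by ext; simp
      rw [e]
      exact Finset.measurableSet_biInter _ fun i _ => measurable_pi_apply i hD
    have := hZB.indep.measure_inter_preimage_eq_mul _ _ hm1 hm2
    simp only [q₀, measureReal_def, ← ENNReal.toReal_mul]
    exact congrArg ENNReal.toReal this
  calc q₀ * Real.exp (-(2 * L * N)) * Real.exp (-(8 * L * N / R ^ 2 * T))
      = q₀ * Real.exp (-(2 * (L * (T / (R / 2) ^ 2 + 1)))) ^ N := by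
        rw [mul_assoc, ← Real.exp_add, ← Real.exp_nat_mul]
        congr 2
        field_simp
        ring
    _ ≤ q₀ * P.real {ω | ∀ i ∈ S, (fun t => B i t ω) ∈ D} := by gcongr
    _ = _ := hind.symm
    _ ≤ P.real (overcrowding (poissonPoint Z B) T R N) := by
        refine ENNReal.toReal_mono (measure_ne_top _ _) (measure_mono_ae ?_)
        filter_upwards [ae_all_iff.2 fun i => (hZB.brownian.brownian i).ae_continuous] with ω hω hE
        intro t ht
        rw [← hSN]
        refine le_pointCount fun i hi => ?_
        have h1 : ‖Z i ω‖ ≤ R / 2 := hE.1 i hi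
        have h2 := norm_sub_le_of_mem_squarePaths (by positivity) (hω i) (hE.2 i hi) ht.2
        rw [sub_zero] at h2
        exact (norm_add_le _ _).trans (by linarith)

/-! ### Lattice models -/

/-- There are `N` points of `ℤ × ℤ` at squared distance at most `8 N` from the origin. -/
lemma exists_lattice_finset (N : ℕ) : ∃ S : Finset (ℤ × ℤ), S.card = N ∧
    ∀ p ∈ S, (p.1 : ℝ) ^ 2 + (p.2 : ℝ) ^ 2 ≤ 8 * N := by
  rcases Nat.eq_zero_or_pos N with rfl | hN
  · exact ⟨∅, by simp⟩
  have h1 : N < (N.sqrt + 1) * (N.sqrt + 1) := Nat.lt_succ_sqrt N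
  have h2 : N.sqrt * N.sqrt ≤ N := Nat.sqrt_le N
  have hcard : N ≤ (Finset.Icc (0 : ℤ) N.sqrt ×ˢ Finset.Icc (0 : ℤ) N.sqrt).card := by
    rw [Finset.card_product, Int.card_Icc]
    have : ((N.sqrt : ℤ) + 1 - 0).toNat = N.sqrt + 1 := by omega
    rw [this]
    exact h1.le
  obtain ⟨S, hS, hSN⟩ := Finset.exists_subset_card_eq hcard
  refine ⟨S, hSN, fun p hp => ?_⟩
  have h3 := hS hp
  rw [Finset.mem_product, Finset.mem_Icc, Finset.mem_Icc] at h3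
  have h4 : p.1 ^ 2 + p.2 ^ 2 ≤ 8 * (N : ℤ) := by
    have h5 : (N.sqrt : ℤ) * N.sqrt ≤ N := by exact_mod_cast h2
    nlinarith [h3.1.1, h3.1.2, h3.2.1, h3.2.2]
  exact_mod_cast h4

/-- Overcrowding rate for models containing the points `a (k + iℓ) + c ζ_{k,ℓ}(t)`: it suffices to
keep the points coming from the `N` sites closest to the origin in the disk. Their distance to the
origin is of order at most `√N`, so that each of them costs a rate of order at most `N`. -/
theorem exists_lattice_rate {a c : ℂ} (hc : c ≠ 0) {R : ℝ} (hR : 0 < R) : ∃ C : ℝ, 0 < C ∧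
    ∀ (Ω : Type*) [MeasurableSpace Ω] (P : Measure Ω) [IsProbabilityMeasure P]
      (B : ℤ × ℤ → ℝ≥0 → Ω → ℂ), IsBrownianFamily B P →
      ∀ {ι : Type} (X : ι → ℝ≥0 → Ω → ℂ) (e : ℤ × ℤ ↪ ι),
        (∀ p t ω, X (e p) t ω =
          a * ((p.1 : ℂ) + Complex.I * (p.2 : ℂ)) + c * ornsteinUhlenbeck (B p) t ω) →
      ∀ N : ℕ, ((-(C * (N : ℝ) ^ 2) : ℝ) : EReal) ≤
        lowerRate P (fun T => overcrowding X T R N) := by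
  have hc' : 0 < ‖c‖ := norm_pos_iff.2 hc
  have hρ : 0 < R / ‖c‖ := by positivity
  obtain ⟨L, hL, h⟩ := exists_ornsteinUhlenbeck_confinement hρ
  let M : ℝ := (‖a‖ / ‖c‖) ^ 2
  have hM : 0 ≤ M := by positivity
  refine ⟨2 * L * (1 + 8 * M), by positivity, fun Ω _ P _ B hB ι X e hX N => ?_⟩
  obtain ⟨S, hSN, hS⟩ := exists_lattice_finset N
  -- `w p` is the position that the process `ζ_p` must have for its point to be at the origin.
  let w : ℤ × ℤ → ℂ := fun p => -(a * ((p.1 : ℂ) + Complex.I * (p.2 : ℂ))) / c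
  have hw (p : ℤ × ℤ) (hp : p ∈ S) : ‖w p‖ ^ 2 ≤ 8 * M * N := by
    have h1 : ‖(p.1 : ℂ) + Complex.I * (p.2 : ℂ)‖ ^ 2 = (p.1 : ℝ) ^ 2 + (p.2 : ℝ) ^ 2 := by
      rw [Complex.sq_norm, Complex.normSq_apply]
      simp
      ring
    have h2 : ‖w p‖ ^ 2 = M * ‖(p.1 : ℂ) + Complex.I * (p.2 : ℂ)‖ ^ 2 := by
      simp only [w, M, norm_div, norm_neg, norm_mul]
      ring
    rw [h2, h1]
    nlinarith [mul_le_mul_of_nonneg_left (hS p hp) hM]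
  choose qre hqre hre using fun p =>
    h Ω P _ (hB.brownian p).re (hB.brownian p).measurable_re (√2 * (w p).re)
  choose qim hqim him using fun p =>
    h Ω P _ (hB.brownian p).im (hB.brownian p).measurable_im (√2 * (w p).im)
  refine neg_le_lowerRate (q := ∏ p ∈ S, qre p * qim p)
    (Finset.prod_pos fun p _ => mul_pos (hqre p) (hqim p)) fun T => ?_
  let D : ℤ × ℤ → Set (ℝ≥0 → ℂ) := fun p => complexOuPath ⁻¹' squarePaths T (w p) (R / ‖c‖)
  have hD (p : ℤ × ℤ) : MeasurableSet (D p) :=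
    measurable_complexOuPath (measurableSet_squarePaths _ _ _)
  have hBp (p : ℤ × ℤ) (hp : p ∈ S) :
      qre p * qim p * Real.exp (-(2 * L * (1 + 8 * M) * N * T)) ≤
        P.real {ω | (fun t => B p t ω) ∈ D p} := by
    have hprod := (hB.brownian p).measureReal_re_im
      (measurable_ouPath (measurableSet_confinedPaths T (√2 * (w p).re) (R / ‖c‖)))
      (measurable_ouPath (measurableSet_confinedPaths T (√2 * (w p).im) (R / ‖c‖)))
    have e : {ω | (fun t => B p t ω) ∈ D p} =
        {ω | (fun t => √2 * (B p t ω).re) ∈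
            ouPath ⁻¹' confinedPaths T (√2 * (w p).re) (R / ‖c‖) ∧
          (fun t => √2 * (B p t ω).im) ∈
            ouPath ⁻¹' confinedPaths T (√2 * (w p).im) (R / ‖c‖)} := by
      ext ω
      simp only [D, squarePaths, Set.mem_preimage, Set.mem_ofPred_eq, scaledRe_complexOuPath,
        scaledIm_complexOuPath]
    rw [e, hprod]
    refine le_trans ?_ (mul_le_mul (hre p T) (him p T)
      (mul_pos (hqim p) (Real.exp_pos _)).le measureReal_nonneg)
    rw [mul_mul_mul_comm, ← Real.exp_add]
    have hq := mul_pos (hqre p) (hqim p)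
    refine mul_le_mul_of_nonneg_left (Real.exp_le_exp.2 ?_) hq.le
    have hN : (1 : ℝ) ≤ N := by
      rw [← hSN]
      exact_mod_cast Finset.card_pos.2 ⟨p, hp⟩
    have hsum : (√2 * (w p).re) ^ 2 + (√2 * (w p).im) ^ 2 = 2 * ‖w p‖ ^ 2 := by
      rw [mul_pow, mul_pow, Real.sq_sqrt zero_le_two, Complex.sq_norm, Complex.normSq_apply]
      ring
    have hrate : (1 + (√2 * (w p).re) ^ 2) + (1 + (√2 * (w p).im) ^ 2) ≤
        2 * ((1 + 8 * M) * N) := by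
      have := hw p hp
      nlinarith
    have := mul_le_mul_of_nonneg_left hrate (by positivity : 0 ≤ L * (T : ℝ))
    linarith
  calc (∏ p ∈ S, qre p * qim p) * Real.exp (-(2 * L * (1 + 8 * M) * N ^ 2 * T))
      = ∏ p ∈ S, qre p * qim p * Real.exp (-(2 * L * (1 + 8 * M) * N * T)) := by
        rw [Finset.prod_mul_distrib (f := fun p => qre p * qim p), Finset.prod_const, hSN,
          ← Real.exp_nat_mul]
        congr 2
        ring
    _ ≤ ∏ p ∈ S, P.real {ω | (fun t => B p t ω) ∈ D p} :=
        Finset.prod_le_prod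
          (fun p _ => (mul_pos (mul_pos (hqre p) (hqim p)) (Real.exp_pos _)).le) hBp
    _ = P.real {ω | ∀ p ∈ S, (fun t => B p t ω) ∈ D p} := (hB.measureReal_forall S hD).symm
    _ ≤ P.real (overcrowding X T R N) := by
        refine ENNReal.toReal_mono (measure_ne_top _ _) (measure_mono_ae ?_)
        filter_upwards [ae_all_iff.2 fun p => (hB.brownian p).ae_continuous] with ω hω hE
        intro t ht
        rw [← hSN, ← Finset.card_map e]
        refine le_pointCount fun i hi => ?_
        obtain ⟨p, hp, rfl⟩ := Finset.mem_map.1 hi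
        have h2 : ‖ornsteinUhlenbeck (B p) t ω - w p‖ ≤ R / ‖c‖ :=
          norm_sub_le_of_mem_squarePaths hρ.le (continuous_complexOuPath (hω p)) (hE p hp) ht.2
        have h3 : X (e p) t ω = c * (ornsteinUhlenbeck (B p) t ω - w p) := by
          rw [hX, mul_sub, mul_div_cancel₀ _ hc]
          ring
        change ‖X (e p) t ω‖ ≤ R
        rw [h3, norm_mul]
        calc ‖c‖ * ‖ornsteinUhlenbeck (B p) t ω - w p‖ ≤ ‖c‖ * (R / ‖c‖) := by gcongr
          _ = R := mul_div_cancel₀ _ hc'.ne'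

end ToyModels

theorem proposition2 :
    (∃ C : ℝ, 0 < C ∧
      ∀ (Ω : Type*) [MeasurableSpace Ω] (P : Measure Ω) [IsProbabilityMeasure P]
        (Z : ℕ → Ω → ℂ) (B : ℕ → ℝ≥0 → Ω → ℂ), IsBrownianPoisson Z B P →
        ∀ R : ℝ, 0 < R → ∀ N : ℕ,
          ((-(C * N / R ^ 2) : ℝ) : EReal) ≤
            lowerRate P (fun T => overcrowding (poissonPoint Z B) T R N)) ∧
    (∀ c : ℂ, c ≠ 0 → ∀ R : ℝ, 0 < R → ∃ C : ℝ, 0 < C ∧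
      ∀ (Ω : Type*) [MeasurableSpace Ω] (P : Measure Ω) [IsProbabilityMeasure P]
        (B : ℤ × ℤ → ℝ≥0 → Ω → ℂ), IsBrownianFamily B P →
        ∀ N : ℕ,
          ((-(C * (N : ℝ) ^ 2) : ℝ) : EReal) ≤
            lowerRate P (fun T => overcrowding (latticePoint c B) T R N) ∧
          ((-(C * (N : ℝ) ^ 2) : ℝ) : EReal) ≤
            lowerRate P (fun T => overcrowding (clusterPoint c B) T R N)) := by
  refine ⟨exists_poisson_rate, fun c hc R hR => ?_⟩
  obtain ⟨C₁, hC₁, h₁⟩ := exists_lattice_rate (a := (√Real.pi : ℂ)) hc hR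
  obtain ⟨C₂, hC₂, h₂⟩ := exists_lattice_rate (a := (√(3 * Real.pi) : ℂ)) hc hR
  refine ⟨C₁ + C₂, by positivity, fun Ω _ P _ B hB N => ⟨?_, ?_⟩⟩
  · refine le_trans (EReal.coe_le_coe_iff.2 (neg_le_neg ?_))
      (h₁ Ω P B hB (latticePoint c B) (Function.Embedding.refl _) (fun _ _ _ => rfl) N)
    gcongr
    linarith
  · refine le_trans (EReal.coe_le_coe_iff.2 (neg_le_neg ?_))
      (h₂ Ω P B hB (clusterPoint c B) ⟨fun p => (p, 0), fun _ _ hp => congrArg Prod.fst hp⟩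
        (fun p t ω => by
          change clusterPoint c B (p, 0) t ω = _
          simp [clusterPoint]) N)
    gcongr
    linarith
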